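/- Let $f=(f_j)_{j\ge 0}$ be a probability distribution on the non-negative integers, let $\nu$ have law $f$, and put $q(z)=\sum_{j\ge0}f_jz^j$, $q_1=\mathbf E\{\nu\}$, $q_2=\mathbf E\{\nu(\nu-1)\}$; assume $q_1<\infty$. Let $Q>0$. A random tree evolves in continuous time from a single living node (the root) at time $0$: each living node lives for an exponentially distributed time with rate $Q$; at the end of its life it dies and is at once replaced by a number of new living nodes (its children) distributed as $\nu$; all lifetimes and all numbers of children are independent. Let $\mu_\ell(t)\in\{0,1,2,\dots\}\cup\{\infty\}$ be the number of living nodes at time $t$. Then for every integer $n\ge0$ the limit $p^{(\ell)}_n=\lim_{t\to\infty}\mathbf P\{\mu_\ell(t)=n\}$ exists, and there is a random variable $\tilde\mu_\ell$ with values in $\{0,1,2,\dots\}\cup\{\infty\}$ (the number of living nodes of the stationary tree) such that $\mathbf P\{\tilde\mu_\ell=n\}=p^{(\ell)}_n$ for all integers $n\ge 0$ and $\mathbf P\{\tilde\mu_\ell=\infty\}=1-\sum_{n\ge0}p^{(\ell)}_n$. Its generating function $g^{(\ell)}(z)=\sum_{n=0}^\infty p^{(\ell)}_nz^n$ has the following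 properties. 1. $q\left[g^{(\ell)}(z)\right]=g^{(\ell)}(z)$ for all $z\in[0,1]$. 2. Subcritical case: if $q_1<1$, then $\mathbf P\{\tilde\mu_\ell=0\}=1$. 3. Supercritical case: if $q_1>1$, then $\mathbf P\{\tilde\mu_\ell>0\}>0$, and $g^{(\ell)}(z)<1$ for all $z\in[0,1]$. 4. If $\nu$ is truncated, i.e. $f_j=0$ for all $j>2$, and $q_1>1$, then $\mathbf P\{\tilde\mu_\ell>0\}=2(q_1-1)/q_2$. -/

import Mathlib

open MeasureTheory ProbabilityTheory Filter Topology

namespace RandomTree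

/-- Generating function `∑ pₙ zⁿ` of a sequence of probabilities indexed by `ℕ`. -/
noncomputable def genFun (p : ℕ → ℝ) (z : ℝ) : ℝ := ∑' n, p n * z ^ n

/-- The `j`-th factorial moment `E[ν (ν - 1) ⋯ (ν - j + 1)]` of a random variable `ν` with law
`f` on `ℕ` (meaningful when the series converges). -/
noncomputable def factorialMoment (f : PMF ℕ) (j : ℕ) : ℝ :=
  ∑' n, (n.descFactorial j : ℝ) * (f n).toReal

/-! Potential nodes are labelled by finite words over `ℕ`: the root is `[]`, and the word
`[i₁, …, iₖ]` labels child number `iₖ` of the node `[i₁, …, iₖ₋₁]`. Hence `i :: w` is the node `w`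
of the tree that grows from child number `i` of the root. Every label `u` carries a pair
`x u = (lifetime, number of children)`. -/

/-- `IsNode x u`: the node `u` is eventually born. -/
def IsNode (x : List ℕ → ℝ × ℕ) : List ℕ → Prop
  | [] => True
  | i :: w => i < (x []).2 ∧ IsNode (fun u => x (i :: u)) w

/-- The birth time of `u`: the sum of the lifetimes of the proper ancestors of `u`. The root is
born at time `0`, any other node at the death of its parent. -/
def birthTime (x : List ℕ → ℝ × ℕ) : List ℕ → ℝ
  | [] => 0
  | i :: w => (x []).1 + birthTime (fun u => x (i :: u)) w

/-- The set of nodes that are living at time `t`: already born and not yet dead. -/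
def livingNodes (x : List ℕ → ℝ × ℕ) (t : ℝ) : Set (List ℕ) :=
  {u | IsNode x u ∧ birthTime x u ≤ t ∧ t < birthTime x u + (x u).1}

/-- The number of living nodes at time `t`. -/
noncomputable def livingCount (x : List ℕ → ℝ × ℕ) (t : ℝ) : ℕ∞ := (livingNodes x t).encard

/-- `X` describes the random evolution of a tree with offspring law `f` and rate `Q`: the labels
carry independent pairs `X u = (lifetime of u, number of children of u)`, in each of which the
lifetime is exponential with rate `Q`, the number of children has law `f`, and the two are
independent. -/
structure IsTreeEvolution {Ω : Type*} [MeasurableSpace Ω] (P : Measure Ω) (Q : ℝ) (f : PMF ℕ)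
    (X : List ℕ → Ω → ℝ × ℕ) : Prop where
  indep : iIndepFun X P
  law : ∀ u, HasLaw (X u) ((expMeasure Q).prod f.toMeasure) P

end RandomTree

/-!
The generating function `F(t) = E[z ^ μ(t)]` of the number of living nodes, with `z ^ ∞ = 0`,
determines the limit law through its two values `z = 0` and one suitable `z` in `(0, 1)`.

Splitting the tree at its root gives independent copies of the tree, one for each child
(`map_graft_treeMeasure`). Conditioning on the label of the root turns this into a renewal equation
(`livingGenFun_renewal`), whose solutions are differentiable and satisfy the backward equation
`F' = Q (q(F) - F)`, `F(0) = z` (`hasDerivAt_livingGenFun`). This is an autonomous equation on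
`[0, 1]`, and its limits are read off the position of the graph of `q` relative to the diagonal.

* If `q₁ ≤ 1` and `f₁ ≠ 1`, then `q(x) > x` on `[0, 1)`, and `F` tends to `η = 1`.
* If `q₁ > 1`, then `q` is strictly convex and crosses the diagonal exactly once in `[0, 1)`, from
  above to below, at a point `η`. Started at `z < 1`, the flow stays away from the unstable fixed
  point `1` and tends to `η`.

In both cases `(F - η) ^ 2` is a Lyapunov function (`tendsto_of_hasDerivAt`). The limit at `z = 0`
is the limit of `P(μ(t) = 0)`; since `z ^ n P(μ(t) = n)` is at most the difference of the generating
functions at `z` and `0`, which have the same limit, `P(μ(t) = n)` tends to `0` for every `n ≥ 1`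
(`tendsto_livingLaw`). So the stationary law gives mass `η` to `0` and mass `1 - η` to `∞`, and its
generating function is the constant `η`, a fixed point of `q`. No discussion of explosion is needed:
the value `∞` at a finite time contributes `0` to `F(t)`.

The remaining case is `f₁ = 1`, where `q(x) = x`, the flow is constant, and exactly one node is
alive at all times.
-/

namespace RandomTree

/-! ### Splitting a tree at its root -/

/-- The labelling of a tree whose root carries the label `a` and whose subtree growing from child
number `i` of the root is labelled by `y i`. -/
def graft (a : ℝ × ℕ) (y : ℕ → List ℕ → ℝ × ℕ) : List ℕ → ℝ × ℕ
  | [] => a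
  | i :: w => y i w

lemma birthTime_nonneg (u : List ℕ) :
    ∀ x : List ℕ → ℝ × ℕ, (∀ v, 0 ≤ (x v).1) → 0 ≤ birthTime x u := by
  induction u with
  | nil => intro x _; exact le_rfl
  | cons i w ih =>
    intro x hx
    exact add_nonneg (hx []) (ih _ fun v => hx (i :: v))

lemma livingCount_graft_of_lt {a : ℝ × ℕ} {y : ℕ → List ℕ → ℝ × ℕ} (hy : ∀ i v, 0 ≤ (y i v).1)
    {t : ℝ} (ht : 0 ≤ t) (hta : t < a.1) : livingCount (graft a y) t = 1 := by
  have : livingNodes (graft a y) t = {[]} := by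
    ext u
    cases u with
    | nil => simpa [livingNodes, IsNode, birthTime, graft] using ⟨ht, hta⟩
    | cons i w =>
      have hb : 0 ≤ birthTime (y i) w := birthTime_nonneg w _ (hy i)
      simp only [livingNodes, Set.mem_ofPred_eq, Set.mem_singleton_iff, reduceCtorEq, iff_false]
      rintro ⟨-, h, -⟩
      change a.1 + birthTime (y i) w ≤ t at h
      linarith
  rw [livingCount, this, Set.encard_singleton]

lemma livingCount_graft_of_le {a : ℝ × ℕ} (y : ℕ → List ℕ → ℝ × ℕ) {t : ℝ} (hta : a.1 ≤ t) :
    livingCount (graft a y) t = ∑ i : Fin a.2, livingCount (y i) (t - a.1) := by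
  have : livingNodes (graft a y) t =
      ⋃ i : Fin a.2, List.cons (i : ℕ) '' livingNodes (y i) (t - a.1) := by
    ext u
    cases u with
    | nil => simpa [livingNodes, IsNode, birthTime, graft] using fun _ => hta
    | cons i w =>
      have h : i :: w ∈ livingNodes (graft a y) t ↔
          i < a.2 ∧ w ∈ livingNodes (y i) (t - a.1) := by
        change ((i < a.2 ∧ IsNode (y i) w) ∧ a.1 + birthTime (y i) w ≤ t ∧
          t < a.1 + birthTime (y i) w + (y i w).1) ↔
          i < a.2 ∧ IsNode (y i) w ∧ birthTime (y i) w ≤ t - a.1 ∧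
          t - a.1 < birthTime (y i) w + (y i w).1
        rw [and_assoc, le_sub_iff_add_le', sub_lt_iff_lt_add', add_assoc]
      rw [h]
      simp only [Set.mem_iUnion, Set.mem_image, List.cons.injEq]
      constructor
      · rintro ⟨hi, hw⟩
        exact ⟨⟨i, hi⟩, w, hw, rfl, rfl⟩
      · rintro ⟨j, v, hv, rfl, rfl⟩
        exact ⟨j.2, hv⟩
  rw [livingCount, this, Set.encard_iUnion_of_finite, finsum_eq_sum_of_fintype]
  · exact Finset.sum_congr rfl fun i _ => (List.cons_injective).encard_image _
  · intro i j hij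
    refine Set.disjoint_left.2 ?_
    rintro _ ⟨v, -, rfl⟩ ⟨w, -, h⟩
    exact hij (Fin.ext (List.cons.inj h).1.symm)

/-! ### Measurability of the number of living nodes -/

lemma measurableSet_isNode (u : List ℕ) : MeasurableSet {x | IsNode x u} := by
  induction u with
  | nil => simp [IsNode]
  | cons i w ih =>
    have h1 : MeasurableSet {x : List ℕ → ℝ × ℕ | i < (x []).2} :=
      measurableSet_lt measurable_const (by fun_prop)
    have h2 : Measurable fun (x : List ℕ → ℝ × ℕ) (u : List ℕ) => x (i :: u) := by fun_prop
    exact h1.inter (h2 ih)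

lemma measurable_birthTime (u : List ℕ) :
    Measurable fun x : List ℕ → ℝ × ℕ => birthTime x u := by
  induction u with
  | nil => exact measurable_const
  | cons i w ih =>
    have h2 : Measurable fun (x : List ℕ → ℝ × ℕ) (u : List ℕ) => x (i :: u) := by fun_prop
    have h1 : Measurable fun x : List ℕ → ℝ × ℕ => (x []).1 := by fun_prop
    exact h1.add (ih.comp h2)

/-- The number of living nodes is a jointly measurable function of the labelling and the time. -/
lemma measurable_livingCount :
    Measurable fun p : (List ℕ → ℝ × ℕ) × ℝ => livingCount p.1 p.2 := by
  have hset (u : List ℕ) :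
      MeasurableSet {p : (List ℕ → ℝ × ℕ) × ℝ | u ∈ livingNodes p.1 p.2} := by
    have hb : Measurable fun p : (List ℕ → ℝ × ℕ) × ℝ => birthTime p.1 u :=
      (measurable_birthTime u).comp measurable_fst
    have hl : Measurable fun p : (List ℕ → ℝ × ℕ) × ℝ => (p.1 u).1 := by fun_prop
    exact (measurable_fst (measurableSet_isNode u)).inter
      ((measurableSet_le hb measurable_snd).inter (measurableSet_lt measurable_snd (hb.add hl)))
  have hs : Measurable fun p : (List ℕ → ℝ × ℕ) × ℝ => livingNodes p.1 p.2 :=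
    measurable_set_iff.2 fun u => measurable_to_prop (by simpa [Set.preimage] using hset u)
  exact measurable_encard.comp hs

/-! ### The law of the labelling -/

/-- The law of the labelling: independent labels, each made of an exponential lifetime with
rate `Q` and an independent number of children with law `f`. -/
noncomputable def treeMeasure (Q : ℝ) (f : PMF ℕ) : Measure (List ℕ → ℝ × ℕ) :=
  Measure.infinitePi fun _ => (expMeasure Q).prod f.toMeasure

lemma isProbabilityMeasure_treeMeasure {Q : ℝ} (hQ : 0 < Q) (f : PMF ℕ) :
    IsProbabilityMeasure (treeMeasure Q f) := by
  have := isProbabilityMeasure_expMeasure hQ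
  unfold treeMeasure
  infer_instance

lemma IsTreeEvolution.hasLaw {Ω : Type*} [MeasurableSpace Ω] {P : Measure Ω}
    {Q : ℝ} {f : PMF ℕ} {X : List ℕ → Ω → ℝ × ℕ} (hX : IsTreeEvolution P Q f X) :
    HasLaw (fun ω u => X u ω) (treeMeasure Q f) P :=
  hX.indep.hasLaw_infinitePi hX.law (aemeasurable_pi_iff.2 fun u => (hX.law u).aemeasurable)

lemma measurable_graft :
    Measurable fun p : (ℝ × ℕ) × (ℕ → List ℕ → ℝ × ℕ) => graft p.1 p.2 := by
  refine measurable_pi_iff.2 fun u => ?_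
  cases u with
  | nil => exact measurable_fst
  | cons i w => simp only [graft]; fun_prop

/-- The branching property: the label of the root and the subtrees growing from the potential
children of the root are independent, and each subtree has the law of the whole tree. -/
lemma map_graft_treeMeasure {Q : ℝ} (hQ : 0 < Q) (f : PMF ℕ) :
    (((expMeasure Q).prod f.toMeasure).prod
      (Measure.infinitePi fun _ : ℕ => treeMeasure Q f)).map (fun p => graft p.1 p.2) =
      treeMeasure Q f := by
  have := isProbabilityMeasure_expMeasure hQ
  have := isProbabilityMeasure_treeMeasure hQ f
  set μ := (expMeasure Q).prod f.toMeasure with hμ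
  refine Measure.eq_infinitePi _ fun s t ht => ?_
  rw [Measure.map_apply measurable_graft (.pi s.countable_toSet fun _ _ => ht _)]
  have hinj : Function.Injective fun p : ℕ × List ℕ => p.1 :: p.2 := by
    rintro ⟨i, v⟩ ⟨j, w⟩ h
    simpa using h
  set s' : Finset (ℕ × List ℕ) := s.preimage (fun p => p.1 :: p.2) hinj.injOn with hs'
  have hN : Measure.infinitePi (fun _ : ℕ => treeMeasure Q f) =
      (Measure.infinitePi fun _ : ℕ × List ℕ => μ).map (MeasurableEquiv.curry ℕ (List ℕ) (ℝ × ℕ)) :=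
    (Measure.infinitePi_map_curry fun (_ : ℕ) (_ : List ℕ) => μ).symm
  -- A box in the coordinates of the grafted tree is a box in the coordinates of its parts.
  have hpre : (fun p : (ℝ × ℕ) × (ℕ → List ℕ → ℝ × ℕ) => graft p.1 p.2) ⁻¹'
      (s : Set (List ℕ)).pi t =
      (if [] ∈ s then t [] else Set.univ) ×ˢ
        ((MeasurableEquiv.curry ℕ (List ℕ) (ℝ × ℕ)).symm ⁻¹'
          (s' : Set (ℕ × List ℕ)).pi fun p => t (p.1 :: p.2)) := by
    ext ⟨a, y⟩
    simp only [Set.mem_preimage, Set.mem_pi, Set.mem_prod, Finset.mem_coe, hs',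
      Finset.mem_preimage]
    constructor
    · intro h
      refine ⟨?_, fun p hp => h _ hp⟩
      split_ifs with h0
      · exact h [] h0
      · trivial
    · rintro ⟨h1, h2⟩ u hu
      cases u with
      | nil => simpa [hu, graft] using h1
      | cons i w => exact h2 (i, w) hu
  have hm : MeasurableSet ((s' : Set (ℕ × List ℕ)).pi fun p => t (p.1 :: p.2)) :=
    .pi s'.countable_toSet fun _ _ => ht _
  rw [hpre, Measure.prod_prod, hN, MeasurableEquiv.map_apply, ← Set.preimage_comp,
    MeasurableEquiv.symm_comp_self, Set.preimage_id, Measure.infinitePi_pi _ fun _ _ => ht _]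
  have hsplit : ∏ u ∈ s, μ (t u) =
      (∏ u ∈ s with u = [], μ (t u)) * ∏ u ∈ s with ¬ u = [], μ (t u) :=
    (Finset.prod_filter_mul_prod_filter_not s _ _).symm
  rw [hsplit]
  congr 1
  · rw [Finset.filter_eq' s []]
    split_ifs <;> simp
  · refine Finset.prod_bij (fun p _ => p.1 :: p.2) ?_ (fun _ _ _ _ h => hinj h) ?_ (fun _ _ => rfl)
    · intro p hp
      simpa [hs'] using hp
    · intro u hu
      cases u with
      | nil => simp at hu
      | cons i w => exact ⟨(i, w), by simpa [hs'] using hu, rfl⟩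

lemma ae_nonneg_lifetime {Q : ℝ} (hQ : 0 < Q) (f : PMF ℕ) :
    ∀ᵐ x ∂treeMeasure Q f, ∀ u, 0 ≤ (x u).1 := by
  have := isProbabilityMeasure_expMeasure hQ
  rw [ae_all_iff]
  intro u
  have h0 : ∀ᵐ s ∂expMeasure Q, 0 ≤ s := by
    have hset : {s : ℝ | ¬ 0 ≤ s} = Set.Iio 0 := by ext; simp
    rw [ae_iff, hset, expMeasure, gammaMeasure, withDensity_apply _ measurableSet_Iio]
    exact lintegral_gammaPDF_of_nonpos le_rfl
  have h1 : ∀ᵐ a ∂(expMeasure Q).prod f.toMeasure, 0 ≤ a.1 :=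
    Measure.quasiMeasurePreserving_fst.ae h0
  exact (measurePreserving_eval_infinitePi
    (fun _ : List ℕ => (expMeasure Q).prod f.toMeasure) u).quasiMeasurePreserving.ae h1

/-! ### Generating functions of probability distributions -/

lemma summable_toReal (f : PMF ℕ) : Summable fun n => (f n).toReal :=
  ENNReal.summable_toReal (by simp [f.tsum_coe])

lemma tsum_toReal (f : PMF ℕ) : ∑' n, (f n).toReal = 1 := by
  rw [← ENNReal.tsum_toReal_eq fun n => f.apply_ne_top n, f.tsum_coe, ENNReal.toReal_one]

lemma toReal_pos {f : PMF ℕ} {n : ℕ} (h : f n ≠ 0) : 0 < (f n).toReal :=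
  ENNReal.toReal_pos h (f.apply_ne_top n)

lemma toReal_le_one (f : PMF ℕ) (n : ℕ) : (f n).toReal ≤ 1 :=
  ENNReal.toReal_le_of_le_ofReal zero_le_one (by simpa using f.coe_le_one n)

lemma toReal_mul_pow_le (f : PMF ℕ) {x : ℝ} (hx : x ∈ Set.Icc (0 : ℝ) 1) (n : ℕ) :
    (f n).toReal * x ^ n ≤ (f n).toReal :=
  mul_le_of_le_one_right ENNReal.toReal_nonneg (pow_le_one₀ hx.1 hx.2)

lemma toReal_mul_pow_nonneg (f : PMF ℕ) {x : ℝ} (hx : x ∈ Set.Icc (0 : ℝ) 1) (n : ℕ) :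
    0 ≤ (f n).toReal * x ^ n :=
  mul_nonneg ENNReal.toReal_nonneg (pow_nonneg hx.1 n)

lemma summable_genFun (f : PMF ℕ) {x : ℝ} (hx : x ∈ Set.Icc (0 : ℝ) 1) :
    Summable fun n => (f n).toReal * x ^ n :=
  .of_nonneg_of_le (toReal_mul_pow_nonneg f hx) (toReal_mul_pow_le f hx) (summable_toReal f)

lemma genFun_one (f : PMF ℕ) : genFun (fun n => (f n).toReal) 1 = 1 := by
  simpa [genFun] using tsum_toReal f

lemma genFun_mem_Icc (f : PMF ℕ) {x : ℝ} (hx : x ∈ Set.Icc (0 : ℝ) 1) :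
    genFun (fun n => (f n).toReal) x ∈ Set.Icc (0 : ℝ) 1 := by
  refine ⟨tsum_nonneg (toReal_mul_pow_nonneg f hx), ?_⟩
  rw [← tsum_toReal f]
  exact (summable_genFun f hx).tsum_le_tsum (toReal_mul_pow_le f hx) (summable_toReal f)

lemma continuousOn_genFun (f : PMF ℕ) :
    ContinuousOn (genFun fun n => (f n).toReal) (Set.Icc 0 1) := by
  refine continuousOn_tsum (fun n => by fun_prop) (summable_toReal f) fun n x hx => ?_
  rw [Real.norm_of_nonneg (toReal_mul_pow_nonneg f hx n)]
  exact toReal_mul_pow_le f hx n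

lemma genFun_eq_integral (f : PMF ℕ) {x : ℝ} (hx : x ∈ Set.Icc (0 : ℝ) 1) :
    genFun (fun n => (f n).toReal) x = ∫ k, x ^ k ∂f.toMeasure := by
  rw [PMF.integral_eq_tsum]
  · simp [genFun]
  · refine Integrable.of_bound (C := 1) (by fun_prop) (ae_of_all _ fun k => ?_)
    rw [Real.norm_of_nonneg (pow_nonneg hx.1 k)]
    exact pow_le_one₀ hx.1 hx.2

lemma factorialMoment_one (f : PMF ℕ) : factorialMoment f 1 = ∑' n : ℕ, (n : ℝ) * (f n).toReal := by
  simp [factorialMoment]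

/-- A law carried by `{0, 1}` has mean at most one. -/
lemma factorialMoment_one_of_le_one {f : PMF ℕ} (h : ∀ j, 2 ≤ j → f j = 0) :
    factorialMoment f 1 = (f 1).toReal := by
  rw [factorialMoment_one, tsum_eq_single 1]
  · simp
  · intro n hn
    rcases n with _ | _ | n
    · simp
    · simp at hn
    · simp [h (n + 1 + 1) (by omega)]

/-- The graph of the generating function lies above its tangent at `1`, strictly on `[0, 1)` unless
the function is affine. -/
lemma tangent_le_genFun {f : PMF ℕ} (hf : Summable fun n : ℕ => (n : ℝ) * (f n).toReal) {x : ℝ}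
    (hx : x ∈ Set.Icc (0 : ℝ) 1) :
    1 - factorialMoment f 1 * (1 - x) ≤ genFun (fun n => (f n).toReal) x ∧
    (x < 1 → (∃ j, 2 ≤ j ∧ f j ≠ 0) →
      1 - factorialMoment f 1 * (1 - x) < genFun (fun n => (f n).toReal) x) := by
  have hs : Summable fun n : ℕ => (f n).toReal - (n : ℝ) * (f n).toReal * (1 - x) :=
    (summable_toReal f).sub (hf.mul_right _)
  have he : 1 - factorialMoment f 1 * (1 - x) =
      ∑' n : ℕ, ((f n).toReal - (n : ℝ) * (f n).toReal * (1 - x)) := by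
    rw [(summable_toReal f).tsum_sub (hf.mul_right _), tsum_toReal, tsum_mul_right,
      factorialMoment_one]
  have hle (n : ℕ) :
      (f n).toReal - (n : ℝ) * (f n).toReal * (1 - x) ≤ (f n).toReal * x ^ n := by
    have h := one_add_mul_le_pow (a := x - 1) (by linarith [hx.1]) n
    rw [add_sub_cancel] at h
    nlinarith [mul_le_mul_of_nonneg_left h (ENNReal.toReal_nonneg (a := f n))]
  rw [he]
  refine ⟨hs.tsum_le_tsum hle (summable_genFun f hx), ?_⟩
  rintro hx1 ⟨j, hj, hfj⟩
  refine hs.tsum_lt_tsum (i := j) hle ?_ (summable_genFun f hx)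
  have h := one_add_mul_self_lt_rpow_one_add (s := x - 1) (by linarith [hx.1])
    (by linarith) (p := j) (by exact_mod_cast hj)
  rw [add_sub_cancel, Real.rpow_natCast] at h
  nlinarith [mul_lt_mul_of_pos_left h (toReal_pos hfj)]

/-- In the subcritical and critical cases the only fixed point in `[0, 1]` is `1`. -/
lemma lt_genFun_of_factorialMoment_le_one {f : PMF ℕ}
    (hf : Summable fun n : ℕ => (n : ℝ) * (f n).toReal) (h1 : factorialMoment f 1 ≤ 1)
    (hf1 : f 1 ≠ 1) {x : ℝ} (hx0 : 0 ≤ x) (hx1 : x < 1) :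
    x < genFun (fun n => (f n).toReal) x := by
  obtain ⟨ha, hb⟩ := tangent_le_genFun hf (x := x) ⟨hx0, hx1.le⟩
  by_cases hj : ∃ j, 2 ≤ j ∧ f j ≠ 0
  · nlinarith [hb hx1 hj]
  · push Not at hj
    have hlt : (f 1).toReal < 1 := by
      refine lt_of_le_of_ne (toReal_le_one f 1) fun h => hf1 ?_
      rw [← ENNReal.ofReal_toReal (f.apply_ne_top 1), h, ENNReal.ofReal_one]
    rw [← factorialMoment_one_of_le_one hj] at hlt
    nlinarith

lemma exists_two_le_of_one_lt_factorialMoment {f : PMF ℕ} (h1 : 1 < factorialMoment f 1) :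
    ∃ j, 2 ≤ j ∧ f j ≠ 0 := by
  by_contra! hj
  rw [factorialMoment_one_of_le_one hj] at h1
  exact (toReal_le_one f 1).not_gt h1

lemma strictConvexOn_genFun {f : PMF ℕ} (hj : ∃ j, 2 ≤ j ∧ f j ≠ 0) :
    StrictConvexOn ℝ (Set.Icc 0 1) (genFun fun n => (f n).toReal) := by
  refine ⟨convex_Icc 0 1, fun x hx y hy hxy a b ha hb hab => ?_⟩
  obtain ⟨j, hj, hfj⟩ := hj
  have hsx := (summable_genFun f hx).mul_left a
  have hsy := (summable_genFun f hy).mul_left b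
  simp only [genFun, smul_eq_mul]
  rw [← tsum_mul_left, ← tsum_mul_left, ← hsx.tsum_add hsy]
  refine (summable_genFun f (convex_Icc 0 1 hx hy ha.le hb.le hab)).tsum_lt_tsum (i := j)
    (fun n => ?_) ?_ (hsx.add hsy)
  · have h := (convexOn_pow n).2 hx.1 hy.1 ha.le hb.le hab
    simp only [smul_eq_mul] at h
    nlinarith [mul_le_mul_of_nonneg_left h (ENNReal.toReal_nonneg (a := f n))]
  · have h := (strictConvexOn_pow hj).2 hx.1 hy.1 hxy ha hb hab
    simp only [smul_eq_mul] at h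
    nlinarith [mul_lt_mul_of_pos_left h (toReal_pos hfj)]

/-- In the supercritical case the left slope `q₁` at `1` exceeds one, so that the graph of the
generating function goes below the diagonal. -/
lemma exists_genFun_lt {f : PMF ℕ}
    (h1 : 1 < factorialMoment f 1) :
    ∃ x, 0 ≤ x ∧ x < 1 ∧ genFun (fun n => (f n).toReal) x < x := by
  by_contra! H
  refine h1.not_ge ?_
  rw [factorialMoment_one]
  refine Real.tsum_le_of_sum_range_le (fun n => by positivity) fun N => ?_
  have hcont : Continuous fun x : ℝ =>
      ∑ n ∈ Finset.range N, (f n).toReal * ∑ i ∈ Finset.range n, x ^ i := by fun_prop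
  have hlim := (hcont.tendsto 1).mono_left (nhdsWithin_le_nhds (s := Set.Iio 1))
  have hval : ∑ n ∈ Finset.range N, (f n).toReal * ∑ i ∈ Finset.range n, (1 : ℝ) ^ i =
      ∑ n ∈ Finset.range N, (n : ℝ) * (f n).toReal := by simp [mul_comm]
  rw [hval] at hlim
  refine le_of_tendsto hlim ?_
  filter_upwards [Ioo_mem_nhdsLT (zero_lt_one' ℝ)] with x hx
  have hx' : x ∈ Set.Icc (0 : ℝ) 1 := Set.Ioo_subset_Icc_self hx
  refine le_of_mul_le_mul_right ?_ (sub_pos.2 hx.2)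
  calc (∑ n ∈ Finset.range N, (f n).toReal * ∑ i ∈ Finset.range n, x ^ i) * (1 - x)
      = ∑ n ∈ Finset.range N, ((f n).toReal - (f n).toReal * x ^ n) := by
        rw [Finset.sum_mul]
        refine Finset.sum_congr rfl fun n _ => ?_
        rw [mul_assoc, geom_sum_mul_neg, mul_sub, mul_one]
    _ ≤ ∑' n, ((f n).toReal - (f n).toReal * x ^ n) :=
        ((summable_toReal f).sub (summable_genFun f hx')).sum_le_tsum _
          fun n _ => sub_nonneg.2 (toReal_mul_pow_le f hx' n)
    _ = 1 - genFun (fun n => (f n).toReal) x := by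
        rw [(summable_toReal f).tsum_sub (summable_genFun f hx'), tsum_toReal, genFun]
    _ ≤ 1 * (1 - x) := by linarith [H x hx.1.le hx.2]

/-- In the supercritical case there is a fixed point `η < 1`, and the graph of the generating
function crosses the diagonal there from above to below. -/
lemma exists_fixedPoint_lt_one {f : PMF ℕ} (h1 : 1 < factorialMoment f 1) :
    ∃ η, 0 ≤ η ∧ η < 1 ∧ genFun (fun n => (f n).toReal) η = η ∧
      (∀ x, 0 ≤ x → x < η → x < genFun (fun n => (f n).toReal) x) ∧
      ∀ x, η < x → x < 1 → genFun (fun n => (f n).toReal) x < x := by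
  obtain ⟨b, hb0, hb1, hb⟩ := exists_genFun_lt h1
  have hconv := strictConvexOn_genFun (exists_two_le_of_one_lt_factorialMoment h1)
  have hcont : ContinuousOn (fun x => genFun (fun n => (f n).toReal) x - x) (Set.Icc 0 b) :=
    ((continuousOn_genFun f).mono (Set.Icc_subset_Icc_right hb1.le)).sub continuousOn_id
  obtain ⟨η, hη, he⟩ := intermediate_value_Icc' hb0 hcont
    (show (0 : ℝ) ∈ Set.Icc _ _ from
      ⟨by linarith, by linarith [(genFun_mem_Icc f (x := 0) (by simp)).1]⟩)
  have he' : genFun (fun n => (f n).toReal) η = η := sub_eq_zero.1 he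
  have hη1 : η < 1 := hη.2.trans_lt hb1
  have hηI : η ∈ Set.Icc (0 : ℝ) 1 := ⟨hη.1, hη1.le⟩
  refine ⟨η, hη.1, hη1, he', fun x hx0 hxη => ?_, fun x hxη hx1 => ?_⟩
  · have h := hconv.slope_strict_mono_adjacent (x := x) (y := η) (z := 1)
      ⟨hx0, by linarith⟩ (by simp) hxη hη1
    rw [he', genFun_one, div_self (sub_pos.2 hη1).ne',
      div_lt_one (by linarith)] at h
    linarith
  · have h := hconv.slope_strict_mono_adjacent (x := η) (y := x) (z := 1)
      hηI (by simp) hxη hx1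
    rw [he', genFun_one, div_lt_div_iff₀ (by linarith) (by linarith)] at h
    by_contra! hle
    nlinarith

/-! ### The generating function of the number of living nodes -/

/-- The power `z ^ m` for `m : ℕ∞`, with the convention `z ^ ∞ = 0` for every `z`. -/
noncomputable def powTop (z : ℝ) (m : ℕ∞) : ℝ := if m = ⊤ then 0 else z ^ m.toNat

@[simp] lemma powTop_natCast (z : ℝ) (n : ℕ) : powTop z n = z ^ n := by simp [powTop]

@[simp] lemma powTop_one (z : ℝ) : powTop z 1 = z := by
  simpa using powTop_natCast z 1

@[simp] lemma powTop_top (z : ℝ) : powTop z ⊤ = 0 := by simp [powTop]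

lemma powTop_add (z : ℝ) (m n : ℕ∞) : powTop z (m + n) = powTop z m * powTop z n := by
  induction m using ENat.recTopCoe with
  | top => simp
  | coe m =>
    induction n using ENat.recTopCoe with
    | top => simp
    | coe n => rw [← Nat.cast_add, powTop_natCast, powTop_natCast, powTop_natCast, pow_add]

lemma powTop_sum {ι : Type*} (z : ℝ) (s : Finset ι) (m : ι → ℕ∞) :
    powTop z (∑ i ∈ s, m i) = ∏ i ∈ s, powTop z (m i) := by
  classical
  induction s using Finset.induction_on with
  | empty => simpa using powTop_natCast z 0
  | insert i s hi ih => rw [Finset.sum_insert hi, Finset.prod_insert hi, powTop_add, ih]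

lemma powTop_mem_Icc {z : ℝ} (hz : z ∈ Set.Icc (0 : ℝ) 1) (m : ℕ∞) :
    powTop z m ∈ Set.Icc (0 : ℝ) 1 := by
  unfold powTop
  split_ifs
  · simp
  · exact ⟨pow_nonneg hz.1 _, pow_le_one₀ hz.1 hz.2⟩

/-- A measurable function with values in `[0, 1]` is integrable for a finite measure. -/
lemma integrable_of_mem_Icc {α : Type*} [MeasurableSpace α] {μ : Measure α} [IsFiniteMeasure μ]
    {g : α → ℝ} (hg : Measurable g) (h : ∀ x, g x ∈ Set.Icc (0 : ℝ) 1) : Integrable g μ := by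
  refine Integrable.of_bound (C := 1) hg.aestronglyMeasurable (ae_of_all _ fun x => ?_)
  rw [Real.norm_of_nonneg (h x).1]
  exact (h x).2

lemma integral_mem_Icc {α : Type*} [MeasurableSpace α] {μ : Measure α} [IsProbabilityMeasure μ]
    {g : α → ℝ} (hg : Measurable g) (h : ∀ x, g x ∈ Set.Icc (0 : ℝ) 1) :
    ∫ x, g x ∂μ ∈ Set.Icc (0 : ℝ) 1 := by
  refine ⟨integral_nonneg fun x => (h x).1, ?_⟩
  calc ∫ x, g x ∂μ ≤ ∫ _, (1 : ℝ) ∂μ :=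
        integral_mono (integrable_of_mem_Icc hg h) (integrable_const 1) fun x => (h x).2
    _ = 1 := by simp

/-- The generating function `E[z ^ μ(t)]` of the number `μ(t)` of living nodes at time `t`, where
`z ^ ∞ = 0`. -/
noncomputable def livingGenFun (Q : ℝ) (f : PMF ℕ) (z t : ℝ) : ℝ :=
  ∫ x, powTop z (livingCount x t) ∂treeMeasure Q f

section

variable {Q : ℝ} (hQ : 0 < Q) (f : PMF ℕ) {z : ℝ} (hz : z ∈ Set.Icc (0 : ℝ) 1)

lemma measurable_powTop_livingCount (z : ℝ) :
    Measurable fun p : (List ℕ → ℝ × ℕ) × ℝ => powTop z (livingCount p.1 p.2) :=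
  (measurable_of_countable (powTop z)).comp measurable_livingCount

lemma measurable_powTop_livingCount_apply (z t : ℝ) :
    Measurable fun x : List ℕ → ℝ × ℕ => powTop z (livingCount x t) :=
  (measurable_powTop_livingCount z).comp (measurable_id.prodMk measurable_const)

include hQ hz in
lemma livingGenFun_mem_Icc (t : ℝ) : livingGenFun Q f z t ∈ Set.Icc (0 : ℝ) 1 := by
  have := isProbabilityMeasure_treeMeasure hQ f
  exact integral_mem_Icc (measurable_powTop_livingCount_apply z t) fun x => powTop_mem_Icc hz _

include hQ in
lemma measurable_livingGenFun (z : ℝ) : Measurable (livingGenFun Q f z) := by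
  have := isProbabilityMeasure_treeMeasure hQ f
  exact (measurable_powTop_livingCount z).stronglyMeasurable.integral_prod_left'.measurable

include hQ hz in
/-- The generating function is computed by conditioning on the label of the root: if the root is
dead at time `t`, the subtrees of its children are independent copies of the tree. -/
lemma livingGenFun_eq_integral_root {t : ℝ} (ht : 0 ≤ t) :
    livingGenFun Q f z t = ∫ a : ℝ × ℕ, (if t < a.1 then z else livingGenFun Q f z (t - a.1) ^ a.2)
      ∂(expMeasure Q).prod f.toMeasure := by
  have := isProbabilityMeasure_expMeasure hQ
  have := isProbabilityMeasure_treeMeasure hQ f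
  have hm : Measurable fun p : (ℝ × ℕ) × (ℕ → List ℕ → ℝ × ℕ) =>
      powTop z (livingCount (graft p.1 p.2) t) :=
    (measurable_powTop_livingCount_apply z t).comp measurable_graft
  have hpos : ∀ᵐ y ∂Measure.infinitePi fun _ : ℕ => treeMeasure Q f, ∀ i v, 0 ≤ (y i v).1 :=
    ae_all_iff.2 fun i => (measurePreserving_eval_infinitePi
      (fun _ : ℕ => treeMeasure Q f) i).quasiMeasurePreserving.ae (ae_nonneg_lifetime hQ f)
  conv_lhs => rw [livingGenFun, ← map_graft_treeMeasure hQ f]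
  rw [integral_map measurable_graft.aemeasurable
    (measurable_powTop_livingCount_apply z t).aestronglyMeasurable,
    integral_prod _ (integrable_of_mem_Icc hm fun _ => powTop_mem_Icc hz _)]
  refine integral_congr_ae (ae_of_all _ fun a => ?_)
  dsimp only
  split_ifs with hta
  · rw [integral_congr_ae (g := fun _ => z)]
    · simp
    · filter_upwards [hpos] with y hy
      rw [livingCount_graft_of_lt hy ht hta, powTop_one]
  · push Not at hta
    simp_rw [livingCount_graft_of_le _ hta, powTop_sum]
    have hind : iIndepFun (fun (i : Fin a.2) (y : ℕ → List ℕ → ℝ × ℕ) => y i)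
        (Measure.infinitePi fun _ : ℕ => treeMeasure Q f) :=
      (iIndepFun_infinitePi (P := fun _ : ℕ => treeMeasure Q f) (X := fun _ y => y)
        fun _ => measurable_id).precomp Fin.val_injective
    have hmap (i : Fin a.2) : (Measure.infinitePi fun _ : ℕ => treeMeasure Q f).map
        (fun y => y (i : ℕ)) = treeMeasure Q f :=
      Measure.infinitePi_map_eval (fun _ : ℕ => treeMeasure Q f) (i : ℕ)
    have hh := measurable_powTop_livingCount_apply z (t - a.1)
    rw [hind.integral_fun_prod_comp (f := fun _ x => powTop z (livingCount x (t - a.1)))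
      (fun i => (measurable_pi_apply _).aemeasurable) fun i => hh.aestronglyMeasurable]
    rw [Finset.prod_congr rfl (g := fun _ => livingGenFun Q f z (t - a.1)) fun i _ => ?_]
    · simp
    · have hh' := hh.aestronglyMeasurable (μ := treeMeasure Q f)
      rw [← hmap i] at hh'
      have heval : Measurable fun y : ℕ → List ℕ → ℝ × ℕ => y i := measurable_pi_apply _
      have hint := integral_map heval.aemeasurable hh'
      rw [hmap i] at hint
      exact hint.symm

include hQ in
/-- Integration against the exponential law, split at time `t`. -/
lemma integral_ite_expMeasure {t : ℝ} (ht : 0 ≤ t) (z : ℝ) {g : ℝ → ℝ} (hg : Measurable g)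
    (hg1 : ∀ s, g s ∈ Set.Icc (0 : ℝ) 1) :
    ∫ s, (if t < s then z else g s) ∂expMeasure Q =
      z * Real.exp (-(Q * t)) + ∫ s in (0 : ℝ)..t, Q * Real.exp (-(Q * s)) * g s := by
  have := isProbabilityMeasure_expMeasure hQ
  have hsplit : (fun s => if t < s then z else g s) =
      fun s => (Set.Ioi t).indicator (fun _ => z) s + (Set.Iic t).indicator g s := by
    ext s
    by_cases h : t < s <;> simp [Set.indicator, h, not_le.2, not_lt.1]
  rw [hsplit, integral_add ((integrable_const z).indicator measurableSet_Ioi)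
    ((integrable_of_mem_Icc hg hg1).indicator measurableSet_Iic)]
  congr 1
  · have hc := cdf_expMeasure_eq hQ t
    rw [if_pos ht, cdf_eq_real] at hc
    rw [integral_indicator_const _ measurableSet_Ioi, ← Set.compl_Iic,
      probReal_compl_eq_one_sub measurableSet_Iic, hc, smul_eq_mul]
    ring
  · have hdens : expMeasure Q =
        volume.withDensity fun s => ENNReal.ofReal (exponentialPDFReal Q s) := rfl
    rw [hdens, integral_withDensity_eq_integral_toReal_smul
      (measurable_exponentialPDFReal Q).ennreal_ofReal
      (ae_of_all _ fun _ => ENNReal.ofReal_lt_top), intervalIntegral.integral_of_le ht,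
      ← integral_Icc_eq_integral_Ioc, ← integral_indicator measurableSet_Icc]
    refine integral_congr_ae (ae_of_all _ fun s => ?_)
    change (exponentialPDF Q s).toReal • _ = _
    rw [exponentialPDF_eq]
    by_cases h0 : 0 ≤ s
    · rw [if_pos h0, ENNReal.toReal_ofReal (by positivity)]
      by_cases h1 : s ≤ t <;> simp [Set.indicator, h0, h1]
    · simp [h0]

include hQ hz in
lemma measurable_genFun_livingGenFun :
    Measurable fun s => genFun (fun n => (f n).toReal) (livingGenFun Q f z s) := by
  simp_rw [fun s => genFun_eq_integral f (livingGenFun_mem_Icc hQ f hz s)]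
  have hm := measurable_livingGenFun hQ f z
  have : Measurable fun p : ℝ × ℕ => livingGenFun Q f z p.1 ^ p.2 :=
    measurable_from_prod_countable_left fun k => hm.pow_const k
  exact this.stronglyMeasurable.integral_prod_right'.measurable

include hQ hz in
/-- The renewal equation of the branching process. -/
lemma livingGenFun_renewal {t : ℝ} (ht : 0 ≤ t) :
    livingGenFun Q f z t = Real.exp (-(Q * t)) * (z + ∫ s in (0 : ℝ)..t,
      Q * Real.exp (Q * s) * genFun (fun n => (f n).toReal) (livingGenFun Q f z s)) := by
  have := isProbabilityMeasure_expMeasure hQ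
  have hm := measurable_livingGenFun hQ f z
  have hF := livingGenFun_mem_Icc hQ f hz
  have hq := measurable_genFun_livingGenFun hQ f hz
  have hmeas : Measurable fun a : ℝ × ℕ =>
      if t < a.1 then z else livingGenFun Q f z (t - a.1) ^ a.2 := by
    refine measurable_from_prod_countable_left fun k => ?_
    exact Measurable.ite measurableSet_Ioi measurable_const
      ((hm.comp (measurable_const.sub measurable_id)).pow_const k)
  rw [livingGenFun_eq_integral_root hQ f hz ht, integral_prod _ (integrable_of_mem_Icc hmeas ?_)]
  · have hinner (s : ℝ) :
        ∫ k : ℕ, (if t < s then z else livingGenFun Q f z (t - s) ^ k) ∂f.toMeasure =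
        if t < s then z else genFun (fun n => (f n).toReal) (livingGenFun Q f z (t - s)) := by
      split_ifs
      · simp
      · rw [genFun_eq_integral f (hF _)]
    simp only [hinner]
    rw [integral_ite_expMeasure hQ ht z
      (g := fun s => genFun (fun n => (f n).toReal) (livingGenFun Q f z (t - s)))
      (hq.comp (measurable_const.sub measurable_id)) fun s => genFun_mem_Icc f (hF _),
      mul_add, mul_comm z]
    congr 1
    have hsub := intervalIntegral.integral_comp_sub_left (a := 0) (b := t) (fun s =>
      Q * Real.exp (-(Q * (t - s))) * genFun (fun n => (f n).toReal) (livingGenFun Q f z s)) t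
    simp only [sub_sub_cancel, sub_zero, sub_self] at hsub
    rw [hsub, ← intervalIntegral.integral_const_mul]
    refine intervalIntegral.integral_congr fun s _ => ?_
    have he : Real.exp (-(Q * (t - s))) = Real.exp (-(Q * t)) * Real.exp (Q * s) := by
      rw [← Real.exp_add]; ring_nf
    simp only [he]
    ring
  · intro a
    split_ifs
    · exact hz
    · exact ⟨pow_nonneg (hF _).1 _, pow_le_one₀ (hF _).1 (hF _).2⟩

include hQ hz in
lemma intervalIntegrable_renewal (a b : ℝ) : IntervalIntegrable (fun s =>
    Q * Real.exp (Q * s) * genFun (fun n => (f n).toReal) (livingGenFun Q f z s)) volume a b := by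
  refine IntervalIntegrable.continuousOn_mul (g := fun s => Q * Real.exp (Q * s)) ?_
    (by fun_prop)
  refine (intervalIntegrable_const (c := (1 : ℝ))).mono_fun
    (measurable_genFun_livingGenFun hQ f hz).aestronglyMeasurable (ae_of_all _ fun s => ?_)
  have h := genFun_mem_Icc f (livingGenFun_mem_Icc hQ f hz s)
  simpa [abs_of_nonneg h.1] using h.2

include hQ hz in
lemma continuousOn_livingGenFun : ContinuousOn (livingGenFun Q f z) (Set.Ici 0) := by
  have hc : Continuous fun t => Real.exp (-(Q * t)) * (z + ∫ s in (0 : ℝ)..t,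
      Q * Real.exp (Q * s) * genFun (fun n => (f n).toReal) (livingGenFun Q f z s)) :=
    (by fun_prop : Continuous fun t => Real.exp (-(Q * t))).mul
      (continuous_const.add (intervalIntegral.continuous_primitive
        (intervalIntegrable_renewal hQ f hz) 0))
  exact hc.continuousOn.congr fun t ht => livingGenFun_renewal hQ f hz ht

include hQ hz in
lemma livingGenFun_zero : livingGenFun Q f z 0 = z := by
  simpa using livingGenFun_renewal hQ f hz le_rfl

include hQ hz in
/-- The backward equation of the branching process. -/
lemma hasDerivAt_livingGenFun {t : ℝ} (ht : 0 < t) :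
    HasDerivAt (livingGenFun Q f z) (Q * (genFun (fun n => (f n).toReal) (livingGenFun Q f z t) -
      livingGenFun Q f z t)) t := by
  have hFc : ContinuousAt (livingGenFun Q f z) t :=
    (continuousOn_livingGenFun hQ f hz).continuousAt (Ici_mem_nhds ht)
  have hqc : ContinuousAt
      (fun s => genFun (fun n => (f n).toReal) (livingGenFun Q f z s)) t := by
    have h1 := continuousOn_genFun f _ (livingGenFun_mem_Icc hQ f hz t)
    exact (h1.tendsto.comp (tendsto_nhdsWithin_iff.2
      ⟨hFc, Eventually.of_forall fun s => livingGenFun_mem_Icc hQ f hz s⟩))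
  have hd := intervalIntegral.integral_hasDerivAt_right (intervalIntegrable_renewal hQ f hz 0 t)
    (((by fun_prop : Measurable fun s => Q * Real.exp (Q * s)).mul
      (measurable_genFun_livingGenFun hQ f hz)).stronglyMeasurable.stronglyMeasurableAtFilter)
    ((by fun_prop : ContinuousAt (fun s => Q * Real.exp (Q * s)) t).mul hqc)
  have he : HasDerivAt (fun t => Real.exp (-(Q * t))) (Real.exp (-(Q * t)) * -Q) t := by
    simpa using (((hasDerivAt_id t).const_mul Q).neg).exp
  have h := (he.mul (hd.const_add z)).congr_of_eventuallyEq (f₁ := livingGenFun Q f z) (by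
    filter_upwards [Ioi_mem_nhds ht] with s hs
    exact livingGenFun_renewal hQ f hz (le_of_lt hs))
  refine h.congr_deriv ?_
  have hexp : Real.exp (-(Q * t)) * Real.exp (Q * t) = 1 := by rw [← Real.exp_add]; simp
  have hr := livingGenFun_renewal hQ f hz ht.le
  linear_combination Q * hr +
    Q * genFun (fun n => (f n).toReal) (livingGenFun Q f z t) * hexp

end

/-! ### Convergence of scalar autonomous flows -/

section Flow

variable {F q : ℝ → ℝ} {Q η b : ℝ}

/-- The squared distance to `η` is a Lyapunov function of the flow `F' = Q (q(F) - F)`. -/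
lemma antitoneOn_sq_sub_add_mul (hc : ContinuousOn F (Set.Ici 0))
    (hd : ∀ t, 0 < t → HasDerivAt F (Q * (q (F t) - F t)) t) {c : ℝ}
    (h : ∀ t, 0 < t → 2 * Q * ((F t - η) * (q (F t) - F t)) ≤ -c) :
    AntitoneOn (fun t => (F t - η) ^ 2 + c * t) (Set.Ici 0) := by
  have hD (t : ℝ) (ht : 0 < t) : HasDerivAt (fun t => (F t - η) ^ 2 + c * t)
      (2 * (F t - η) * (Q * (q (F t) - F t)) + c) t := by
    refine ((((hd t ht).sub_const η).pow 2).add ((hasDerivAt_id t).const_mul c)).congr_deriv ?_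
    simp
  refine antitoneOn_of_deriv_nonpos (convex_Ici 0) ?_ ?_ ?_
  · exact ((hc.sub continuousOn_const).pow 2).add (by fun_prop)
  · intro t ht
    rw [interior_Ici] at ht
    exact (hD t ht).differentiableAt.differentiableWithinAt
  · intro t ht
    rw [interior_Ici] at ht
    rw [(hD t ht).deriv]
    linarith [h t ht]

lemma antitoneOn_sq_sub (hQ : 0 < Q) (hc : ContinuousOn F (Set.Ici 0))
    (hd : ∀ t, 0 < t → HasDerivAt F (Q * (q (F t) - F t)) t)
    (h : ∀ t, 0 < t → (F t - η) * (q (F t) - F t) ≤ 0) :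
    AntitoneOn (fun t => (F t - η) ^ 2) (Set.Ici 0) := by
  simpa using antitoneOn_sq_sub_add_mul (c := 0) hc hd fun t ht => by nlinarith [h t ht]

/-- A solution of `F' = Q (q(F) - F)` that remains in an interval on which `q(x) - x` pulls
towards `η`, and vanishes at most at `η`, converges to `η`. -/
lemma tendsto_of_hasDerivAt (hQ : 0 < Q) (hc : ContinuousOn F (Set.Ici 0))
    (hd : ∀ t, 0 < t → HasDerivAt F (Q * (q (F t) - F t)) t)
    (hF : ∀ t, 0 ≤ t → F t ∈ Set.Icc 0 b) (hq : ContinuousOn q (Set.Icc 0 b))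
    (h : ∀ x ∈ Set.Icc 0 b, x ≠ η → (x - η) * (q x - x) < 0) :
    Tendsto F atTop (𝓝 η) := by
  have hV : AntitoneOn (fun t => (F t - η) ^ 2) (Set.Ici 0) := by
    refine antitoneOn_sq_sub hQ hc hd fun t ht => ?_
    by_cases hx : F t = η
    · simp [hx]
    · exact (h _ (hF t ht.le) hx).le
  rw [Metric.tendsto_atTop]
  intro ε hε
  -- By monotonicity it is enough to come close to `η` once.
  suffices ∃ T, 0 ≤ T ∧ (F T - η) ^ 2 < ε ^ 2 by
    obtain ⟨T, hT, hlt⟩ := this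
    refine ⟨T, fun t ht => ?_⟩
    rw [Real.dist_eq]
    exact abs_lt_of_sq_lt_sq ((hV hT (hT.trans ht) ht).trans_lt hlt) hε.le
  by_contra! hfar
  -- On the compact set of points at distance at least `ε` from `η` the decay rate of the Lyapunov
  -- function is bounded away from zero, which is impossible for all times.
  have hK : IsCompact (Set.Icc 0 b ∩ {x | ε ^ 2 ≤ (x - η) ^ 2}) :=
    isCompact_Icc.inter_right (t := {x | ε ^ 2 ≤ (x - η) ^ 2})
      (isClosed_le continuous_const (by fun_prop))
  have hψ : ContinuousOn (fun x => 2 * Q * ((x - η) * (q x - x)))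
      (Set.Icc 0 b ∩ {x | ε ^ 2 ≤ (x - η) ^ 2}) :=
    continuousOn_const.mul ((by fun_prop : ContinuousOn (fun x => x - η) _).mul
      ((hq.mono fun x hx => hx.1).sub continuousOn_id))
  obtain ⟨m, hm, hmax⟩ := hK.exists_isMaxOn ⟨F 0, hF 0 le_rfl, hfar 0 le_rfl⟩ hψ
  have hmη : m ≠ η := by
    rintro rfl
    have hle : ε ^ 2 ≤ (m - m) ^ 2 := hm.2
    rw [sub_self] at hle
    nlinarith [pow_pos hε 2]
  set c := -(2 * Q * ((m - η) * (q m - m))) with hcdef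
  have hcpos : 0 < c := by nlinarith [h m hm.1 hmη]
  have hW := antitoneOn_sq_sub_add_mul (η := η) (c := c) hc hd fun t ht => by
    rw [hcdef, neg_neg]
    exact hmax ⟨hF t ht.le, hfar t ht.le⟩
  have hT : 0 ≤ (F 0 - η) ^ 2 / c := by positivity
  have h1 := hW (Set.self_mem_Ici) hT hT
  simp only [mul_zero, add_zero, mul_div_cancel₀ _ hcpos.ne'] at h1
  nlinarith [hfar _ hT, pow_pos hε 2]

end Flow

/-! ### Probabilities and generating functions of laws on the extended natural numbers -/

section Law

variable (m : Measure ℕ∞) [IsProbabilityMeasure m]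

lemma integrable_powTop {z : ℝ} (hz : z ∈ Set.Icc (0 : ℝ) 1) : Integrable (powTop z) m :=
  integrable_of_mem_Icc (measurable_of_countable _) (powTop_mem_Icc hz)

lemma powTop_zero_eq_indicator :
    powTop 0 = Set.indicator {(0 : ℕ∞)} fun _ => (1 : ℝ) := by
  ext k
  induction k using ENat.recTopCoe with
  | top => simp
  | coe k => rcases k with _ | k <;> simp [powTop]

omit [IsProbabilityMeasure m] in
lemma integral_powTop_zero : ∫ k, powTop 0 k ∂m = m.real {0} := by
  rw [powTop_zero_eq_indicator, integral_indicator_const _ (measurableSet_singleton _)]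
  simp

lemma pow_mul_measureReal_le {z : ℝ} (hz : z ∈ Set.Icc (0 : ℝ) 1) {n : ℕ} (hn : n ≠ 0) :
    z ^ n * m.real {(n : ℕ∞)} ≤ ∫ k, powTop z k ∂m - ∫ k, powTop 0 k ∂m := by
  rw [← integral_sub (integrable_powTop m hz) (integrable_powTop m (by simp))]
  have : z ^ n * m.real {(n : ℕ∞)} =
      ∫ k, Set.indicator {(n : ℕ∞)} (fun _ => z ^ n) k ∂m := by
    rw [integral_indicator_const _ (measurableSet_singleton _), smul_eq_mul, mul_comm]
  rw [this]
  refine integral_mono ((integrable_const _).indicator (measurableSet_singleton _))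
    ((integrable_powTop m hz).sub (integrable_powTop m (by simp))) fun k => ?_
  induction k using ENat.recTopCoe with
  | top => simp
  | coe k =>
    by_cases hk : k = n
    · subst hk; simp [hn]
    · rw [Set.indicator_of_notMem (by simpa using hk), powTop_natCast, powTop_natCast]
      rcases k with _ | k
      · simp
      · simpa using pow_nonneg hz.1 _

/-- A law with generating function `z` is carried by `1`. -/
lemma measureReal_singleton_one_eq_one
    (h : ∀ z ∈ Set.Icc (0 : ℝ) 1, ∫ k, powTop z k ∂m = z) : m.real {1} = 1 := by
  refine le_antisymm measureReal_le_one ?_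
  refine le_of_forall_pos_lt_add fun ε hε => ?_
  have h0 : m.real {0} = 0 := by rw [← integral_powTop_zero, h 0 (by simp)]
  -- From `z = E[z ^ k] ≤ z P(k = 1) + P(k = 0) + z ^ 2` and `P(k = 0) = 0`; then `z` tends to `0`.
  have key (z : ℝ) (hz0 : 0 < z) (hz1 : z ≤ 1) : 1 ≤ m.real {1} + z := by
    have hz : z ∈ Set.Icc (0 : ℝ) 1 := ⟨hz0.le, hz1⟩
    have h1 := (integrable_const (μ := m) z).indicator (measurableSet_singleton (1 : ℕ∞))
    have h2 := (integrable_const (μ := m) (1 : ℝ)).indicator (measurableSet_singleton (0 : ℕ∞))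
    have hle : ∫ k, powTop z k ∂m ≤ ∫ k, ((Set.indicator {(1 : ℕ∞)} (fun _ => z) +
        Set.indicator {(0 : ℕ∞)} (fun _ => (1 : ℝ))) k + z ^ 2) ∂m := by
      refine integral_mono (integrable_powTop m hz) ((h1.add h2).add (integrable_const _))
        fun k => ?_
      induction k using ENat.recTopCoe with
      | top => simpa using sq_nonneg z
      | coe k =>
        rcases k with _ | _ | k
        · simp [powTop, sq_nonneg z]
        · simp [sq_nonneg z]
        · have hz2 : z ^ (k + 1 + 1) ≤ z ^ 2 := pow_le_pow_of_le_one hz0.le hz1 (by omega)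
          have hne1 : ((k + 1 + 1 : ℕ) : ℕ∞) ≠ 1 := by
            exact_mod_cast (by omega : k + 1 + 1 ≠ 1)
          have hne0 : ((k + 1 + 1 : ℕ) : ℕ∞) ≠ 0 := by
            exact_mod_cast (by omega : k + 1 + 1 ≠ 0)
          rw [powTop_natCast, Pi.add_apply, Set.indicator_of_notMem (Set.mem_singleton_iff.not.2 hne1),
            Set.indicator_of_notMem (Set.mem_singleton_iff.not.2 hne0)]
          linarith
    rw [h z hz, integral_add (h1.add h2) (integrable_const _), integral_add' h1 h2,
      integral_indicator_const _ (measurableSet_singleton _),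
      integral_indicator_const _ (measurableSet_singleton _), h0] at hle
    simp only [smul_eq_mul, zero_mul, add_zero, integral_const, probReal_univ, one_mul] at hle
    nlinarith
  have := key (min (ε / 2) 1) (by positivity) (min_le_right _ _)
  linarith [min_le_left (ε / 2) 1]

end Law

/-! ### Convergence of the number of living nodes -/

/-- The law of the number of living nodes at time `t`. -/
noncomputable def livingLaw (Q : ℝ) (f : PMF ℕ) (t : ℝ) : Measure ℕ∞ :=
  (treeMeasure Q f).map fun x => livingCount x t

lemma measurable_livingCount_apply (t : ℝ) :
    Measurable fun x : List ℕ → ℝ × ℕ => livingCount x t :=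
  measurable_livingCount.comp (measurable_id.prodMk measurable_const)

lemma IsTreeEvolution.measureReal_livingCount {Ω : Type*} [MeasurableSpace Ω] {P : Measure Ω}
    {Q : ℝ} {f : PMF ℕ} {X : List ℕ → Ω → ℝ × ℕ} (hX : IsTreeEvolution P Q f X) (t : ℝ)
    (n : ℕ∞) :
    P.real {ω | livingCount (fun u => X u ω) t = n} = (livingLaw Q f t).real {n} := by
  rw [livingLaw, map_measureReal_apply (measurable_livingCount_apply t)
    (measurableSet_singleton n)]
  exact hX.hasLaw.measureReal_eq
    (measurable_livingCount_apply t (measurableSet_singleton n))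

section

variable {Q : ℝ} (hQ : 0 < Q) {f : PMF ℕ}

include hQ in
lemma isProbabilityMeasure_livingLaw (t : ℝ) : IsProbabilityMeasure (livingLaw Q f t) := by
  have := isProbabilityMeasure_treeMeasure hQ f
  exact Measure.isProbabilityMeasure_map (measurable_livingCount_apply t).aemeasurable

lemma integral_powTop_livingLaw (z t : ℝ) :
    ∫ k, powTop z k ∂livingLaw Q f t = livingGenFun Q f z t :=
  integral_map (measurable_livingCount_apply t).aemeasurable
    (measurable_of_countable _).aestronglyMeasurable

include hQ in
lemma livingGenFun_zero_le {z : ℝ} (hz : z ∈ Set.Icc (0 : ℝ) 1) (t : ℝ) :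
    livingGenFun Q f 0 t ≤ livingGenFun Q f z t := by
  have := isProbabilityMeasure_livingLaw hQ (f := f) t
  rw [← integral_powTop_livingLaw, ← integral_powTop_livingLaw, ← sub_nonneg]
  have h := pow_mul_measureReal_le (livingLaw Q f t) hz one_ne_zero
  exact (mul_nonneg (pow_nonneg hz.1 _) measureReal_nonneg).trans h

include hQ in
/-- If the generating function has the same limit at `0` and at some `z > 0`, all the mass that
does not go to `0` escapes to infinity. -/
lemma tendsto_livingLaw {z η : ℝ} (hz0 : 0 < z) (hz1 : z ≤ 1)
    (h0 : Tendsto (livingGenFun Q f 0) atTop (𝓝 η))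
    (hz : Tendsto (livingGenFun Q f z) atTop (𝓝 η)) (n : ℕ) :
    Tendsto (fun t => (livingLaw Q f t).real {(n : ℕ∞)}) atTop (𝓝 (if n = 0 then η else 0)) := by
  have hprob := isProbabilityMeasure_livingLaw hQ (f := f)
  by_cases hn : n = 0
  · subst hn
    refine h0.congr fun t => ?_
    rw [← integral_powTop_livingLaw, integral_powTop_zero, Nat.cast_zero]
  · rw [if_neg hn]
    have hlim : Tendsto (fun t => (livingGenFun Q f z t - livingGenFun Q f 0 t) / z ^ n) atTop
        (𝓝 0) := by simpa using (hz.sub h0).div_const (z ^ n)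
    refine squeeze_zero (fun _ => measureReal_nonneg) (fun t => ?_) hlim
    rw [le_div_iff₀' (by positivity), ← integral_powTop_livingLaw, ← integral_powTop_livingLaw]
    exact pow_mul_measureReal_le _ ⟨hz0.le, hz1⟩ hn

include hQ in
lemma tendsto_livingLaw_of_factorialMoment_le_one (hf : Summable fun n : ℕ => (n : ℝ) * (f n).toReal)
    (h1 : factorialMoment f 1 ≤ 1) (hf1 : f 1 ≠ 1) (n : ℕ) :
    Tendsto (fun t => (livingLaw Q f t).real {(n : ℕ∞)}) atTop (𝓝 (if n = 0 then 1 else 0)) := by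
  have key (z : ℝ) (hz : z ∈ Set.Icc (0 : ℝ) 1) : Tendsto (livingGenFun Q f z) atTop (𝓝 1) :=
    tendsto_of_hasDerivAt hQ (continuousOn_livingGenFun hQ f hz)
      (fun t ht => hasDerivAt_livingGenFun hQ f hz ht)
      (fun t _ => livingGenFun_mem_Icc hQ f hz t) (continuousOn_genFun f) fun x hx hx1 => by
        have hlt : x < 1 := lt_of_le_of_ne hx.2 hx1
        nlinarith [lt_genFun_of_factorialMoment_le_one hf h1 hf1 hx.1 hlt]
  exact tendsto_livingLaw hQ one_half_pos (by norm_num) (key 0 (by simp))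
    (key (1 / 2) (by norm_num)) n

include hQ in
lemma tendsto_livingLaw_of_fixedPoint_lt_one {η : ℝ} (hη0 : 0 ≤ η) (hη1 : η < 1)
    (hbelow : ∀ x, 0 ≤ x → x < η → x < genFun (fun n => (f n).toReal) x)
    (habove : ∀ x, η < x → x < 1 → genFun (fun n => (f n).toReal) x < x) (n : ℕ) :
    Tendsto (fun t => (livingLaw Q f t).real {(n : ℕ∞)}) atTop (𝓝 (if n = 0 then η else 0)) := by
  have hsign (x : ℝ) (hx0 : 0 ≤ x) (hx1 : x < 1) (hx : x ≠ η) :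
      (x - η) * (genFun (fun n => (f n).toReal) x - x) < 0 := by
    rcases lt_or_gt_of_ne hx with h | h
    · nlinarith [hbelow x hx0 h]
    · nlinarith [habove x h hx1]
  have hsign' (x : ℝ) (hx : x ∈ Set.Icc (0 : ℝ) 1) :
      (x - η) * (genFun (fun n => (f n).toReal) x - x) ≤ 0 := by
    rcases hx.2.eq_or_lt with rfl | hx1
    · simp [genFun_one]
    · by_cases hxη : x = η
      · simp [hxη]
      · exact (hsign x hx.1 hx1 hxη).le
  -- Started at `z` between `η` and `1`, the flow never exceeds `z`, and this bounds the flow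
  -- started at `0` as well.
  obtain ⟨z, hηz, hz1⟩ := exists_between hη1
  have hz : z ∈ Set.Icc (0 : ℝ) 1 := ⟨hη0.trans hηz.le, hz1.le⟩
  have hle (t : ℝ) (ht : 0 ≤ t) : livingGenFun Q f z t ≤ z := by
    have hV := antitoneOn_sq_sub (η := η) hQ (continuousOn_livingGenFun hQ f hz)
      (fun t ht => hasDerivAt_livingGenFun hQ f hz ht)
      (fun t _ => hsign' _ (livingGenFun_mem_Icc hQ f hz t)) Set.self_mem_Ici ht ht
    simp only [livingGenFun_zero hQ f hz] at hV
    have := abs_le_of_sq_le_sq hV (sub_nonneg.2 hηz.le)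
    linarith [le_abs_self (livingGenFun Q f z t - η)]
  have key (y : ℝ) (hy : y ∈ Set.Icc (0 : ℝ) 1)
      (hyz : ∀ t, 0 ≤ t → livingGenFun Q f y t ≤ z) :
      Tendsto (livingGenFun Q f y) atTop (𝓝 η) :=
    tendsto_of_hasDerivAt hQ (continuousOn_livingGenFun hQ f hy)
      (fun t ht => hasDerivAt_livingGenFun hQ f hy ht)
      (fun t ht => ⟨(livingGenFun_mem_Icc hQ f hy t).1, hyz t ht⟩)
      ((continuousOn_genFun f).mono (Set.Icc_subset_Icc_right hz1.le))
      fun x hx hxη => hsign x hx.1 (hx.2.trans_lt hz1) hxη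
  exact tendsto_livingLaw hQ (hη0.trans_lt hηz) hz1.le
    (key 0 (by simp) fun t ht => (livingGenFun_zero_le hQ hz t).trans (hle t ht))
    (key z hz hle) n

lemma genFun_of_apply_one (hf1 : f 1 = 1) (x : ℝ) : genFun (fun n => (f n).toReal) x = x := by
  have hs : f.support = {1} := (f.apply_eq_one_iff 1).1 hf1
  rw [genFun, tsum_eq_single 1]
  · simp [hf1]
  · intro n hn
    have : f n = 0 := by
      rw [f.apply_eq_zero_iff, hs]
      simpa using hn
    simp [this]

include hQ in
/-- If every node has exactly one child, there is always exactly one living node. -/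
lemma livingLaw_of_apply_one (hf1 : f 1 = 1) {t : ℝ} (ht : 0 ≤ t) (n : ℕ) :
    (livingLaw Q f t).real {(n : ℕ∞)} = if n = 1 then 1 else 0 := by
  have hprob := isProbabilityMeasure_livingLaw hQ (f := f) t
  have h1 : (livingLaw Q f t).real {1} = 1 := by
    refine measureReal_singleton_one_eq_one _ fun z hz => ?_
    rw [integral_powTop_livingLaw]
    have hV := antitoneOn_sq_sub (η := z) hQ (continuousOn_livingGenFun hQ f hz)
      (fun t ht => hasDerivAt_livingGenFun hQ f hz ht)
      (fun t _ => by simp [genFun_of_apply_one hf1]) Set.self_mem_Ici ht ht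
    simp only [livingGenFun_zero hQ f hz, sub_self, ne_eq, OfNat.ofNat_ne_zero,
      not_false_eq_true, zero_pow] at hV
    exact sub_eq_zero.1 (pow_eq_zero_iff two_ne_zero |>.1 (le_antisymm hV (sq_nonneg _)))
  split_ifs with hn
  · subst hn; exact h1
  · have hc := probReal_compl_eq_one_sub (μ := livingLaw Q f t) (measurableSet_singleton 1)
    rw [h1, sub_self] at hc
    refine le_antisymm (hc ▸ measureReal_mono ?_) measureReal_nonneg
    simpa [eq_comm] using hn

end

/-! ### The stationary law -/

/-- The law that gives mass `η` to `0` and mass `1 - η` to `∞`. -/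
noncomputable def extinctionLaw (η : ℝ) : Measure ℕ∞ :=
  ENNReal.ofReal η • Measure.dirac 0 + ENNReal.ofReal (1 - η) • Measure.dirac ⊤

section

variable {η : ℝ} (hη0 : 0 ≤ η) (hη1 : η ≤ 1)

include hη0 hη1 in
lemma isProbabilityMeasure_extinctionLaw : IsProbabilityMeasure (extinctionLaw η) := by
  constructor
  simp only [extinctionLaw, Measure.coe_add, Measure.coe_smul, Pi.add_apply, Pi.smul_apply,
    measure_univ, smul_eq_mul, mul_one]
  rw [← ENNReal.ofReal_add hη0 (sub_nonneg.2 hη1), add_sub_cancel, ENNReal.ofReal_one]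

lemma extinctionLaw_zero (η : ℝ) : extinctionLaw η {0} = ENNReal.ofReal η := by
  simp [extinctionLaw]

lemma extinctionLaw_pos (η : ℝ) : extinctionLaw η {m | 0 < m} = ENNReal.ofReal (1 - η) := by
  simp [extinctionLaw]

include hη0 in
lemma extinctionLaw_real_natCast (n : ℕ) :
    (extinctionLaw η).real {(n : ℕ∞)} = if n = 0 then η else 0 := by
  split_ifs with hn
  · subst hn
    rw [Nat.cast_zero, Measure.real, extinctionLaw_zero, ENNReal.toReal_ofReal hη0]
  · have hn' : ((n : ℕ) : ℕ∞) ≠ 0 := by exact_mod_cast hn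
    simp [Measure.real, extinctionLaw, hn'.symm]

include hη0 in
lemma genFun_extinctionLaw (z : ℝ) :
    genFun (fun n => (extinctionLaw η).real {(n : ℕ∞)}) z = η := by
  simp only [extinctionLaw_real_natCast hη0]
  rw [genFun, tsum_eq_single 0]
  · simp
  · intro n hn
    simp [hn]

end

/-- For at most two children, the fixed point equation is quadratic, with roots `1` and `η`. -/
lemma one_sub_fixedPoint_of_truncated {f : PMF ℕ} (hf : ∀ n, 2 < n → f n = 0)
    (h1 : 1 < factorialMoment f 1) {η : ℝ} (hη1 : η < 1)
    (hη : genFun (fun n => (f n).toReal) η = η) :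
    1 - η = 2 * (factorialMoment f 1 - 1) / factorialMoment f 2 := by
  have hsum (g : ℕ → ℝ) (hg : ∀ n, f n = 0 → g n = 0) : ∑' n, g n = g 0 + g 1 + g 2 := by
    rw [tsum_eq_sum (s := Finset.range 3) fun n hn => hg n (hf n (by simp at hn; omega))]
    simp [Finset.sum_range_succ]
  have h2 : 0 < (f 2).toReal := by
    obtain ⟨j, hj, hfj⟩ := exists_two_le_of_one_lt_factorialMoment h1
    rcases hj.eq_or_lt with rfl | hj
    · exact toReal_pos hfj
    · exact absurd (hf j hj) hfj
  have e0 := tsum_toReal f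
  rw [hsum _ fun n hn => by simp [hn]] at e0
  have e1 : factorialMoment f 1 = (f 1).toReal + 2 * (f 2).toReal := by
    rw [factorialMoment_one, hsum _ fun n hn => by simp [hn]]
    simp
  have e2 : factorialMoment f 2 = 2 * (f 2).toReal := by
    rw [factorialMoment, hsum _ fun n hn => by simp [hn]]
    simp [Nat.descFactorial]
  rw [genFun, hsum _ fun n hn => by simp [hn]] at hη
  simp only [pow_zero, mul_one, pow_one] at hη
  have hroot : (1 - η) * ((f 0).toReal - (f 2).toReal * η) = 0 := by
    linear_combination hη - η * e0
  have hroot' := (mul_eq_zero.1 hroot).resolve_left (sub_pos.2 hη1).ne'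
  rw [e1, e2, eq_div_iff (by positivity)]
  linear_combination 2 * hroot' - 2 * e0

end RandomTree

theorem mainTheorem3 {Ω : Type*} [MeasurableSpace Ω] (P : Measure Ω) [IsProbabilityMeasure P]
    (Q : ℝ) (hQ : 0 < Q) (f : PMF ℕ) (hf : Summable fun n : ℕ => (n : ℝ) * (f n).toReal)
    (X : List ℕ → Ω → ℝ × ℕ) (hX : RandomTree.IsTreeEvolution P Q f X) :
    ∃ π : Measure ℕ∞, IsProbabilityMeasure π ∧
      (∀ n : ℕ, Tendsto (fun t : ℝ => P.real {ω | RandomTree.livingCount (fun u => X u ω) t = n})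
        atTop (𝓝 (π.real {(n : ℕ∞)}))) ∧
      (∀ z ∈ Set.Icc (0 : ℝ) 1,
        RandomTree.genFun (fun n => (f n).toReal)
            (RandomTree.genFun (fun n => π.real {(n : ℕ∞)}) z) =
          RandomTree.genFun (fun n => π.real {(n : ℕ∞)}) z) ∧
      (RandomTree.factorialMoment f 1 < 1 → π {0} = 1) ∧
      (1 < RandomTree.factorialMoment f 1 →
        0 < π {m | 0 < m} ∧
        ∀ z ∈ Set.Icc (0 : ℝ) 1, RandomTree.genFun (fun n => π.real {(n : ℕ∞)}) z < 1) ∧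
      ((∀ n, 2 < n → f n = 0) → 1 < RandomTree.factorialMoment f 1 →
        π.real {m | 0 < m} =
          2 * (RandomTree.factorialMoment f 1 - 1) / RandomTree.factorialMoment f 2) := by
  open RandomTree in
  simp only [hX.measureReal_livingCount]
  by_cases hf1 : f 1 = 1
  · have hmean : factorialMoment f 1 = 1 := by
      rw [factorialMoment_one_of_le_one, hf1, ENNReal.toReal_one]
      intro j hj
      rw [f.apply_eq_zero_iff, (f.apply_eq_one_iff 1).1 hf1]
      simp only [Set.mem_singleton_iff]
      omega
    refine ⟨Measure.dirac 1, inferInstance, fun n => ?_, fun z _ => genFun_of_apply_one hf1 _,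
      fun h => absurd h hmean.not_lt, fun h => absurd h hmean.not_gt,
      fun _ h => absurd h hmean.not_gt⟩
    have hd : (Measure.dirac (1 : ℕ∞)).real {(n : ℕ∞)} = if n = 1 then 1 else 0 := by
      simp [Measure.real, Set.indicator, eq_comm, apply_ite]
    rw [hd]
    refine tendsto_const_nhds.congr' ?_
    filter_upwards [eventually_ge_atTop 0] with t ht
    exact (livingLaw_of_apply_one hQ hf1 ht n).symm
  rcases le_or_gt (factorialMoment f 1) 1 with h1 | h1
  · refine ⟨extinctionLaw 1, isProbabilityMeasure_extinctionLaw zero_le_one le_rfl, fun n => ?_,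
      fun z _ => ?_, fun _ => by simp [extinctionLaw_zero], fun h => absurd h h1.not_gt,
      fun _ h => absurd h h1.not_gt⟩
    · rw [extinctionLaw_real_natCast zero_le_one]
      exact tendsto_livingLaw_of_factorialMoment_le_one hQ hf h1 hf1 n
    · rw [genFun_extinctionLaw zero_le_one, genFun_one]
  · obtain ⟨η, hη0, hη1, hη, hbelow, habove⟩ := exists_fixedPoint_lt_one h1
    refine ⟨extinctionLaw η, isProbabilityMeasure_extinctionLaw hη0 hη1.le, fun n => ?_,
      fun z _ => ?_, fun h => absurd h h1.not_gt, fun _ => ⟨?_, fun z _ => ?_⟩, fun h2 _ => ?_⟩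
    · rw [extinctionLaw_real_natCast hη0]
      exact tendsto_livingLaw_of_fixedPoint_lt_one hQ hη0 hη1 hbelow habove n
    · rw [genFun_extinctionLaw hη0, hη]
    · rw [extinctionLaw_pos]
      exact ENNReal.ofReal_pos.2 (sub_pos.2 hη1)
    · rwa [genFun_extinctionLaw hη0]
    · rw [Measure.real, extinctionLaw_pos, ENNReal.toReal_ofReal (sub_nonneg.2 hη1.le)]
      exact one_sub_fixedPoint_of_truncated h2 h1 hη1 hη
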